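/- **Staircases.** A *column* $u=[u_1,\dots,u_k]$ is a strictly decreasing sequence of positive integers, written from top to bottom. A *staircase* is a nonempty sequence of columns of lengths $k,k-1,\dots,k-r$ such that, aligning the columns at their bottoms, rows are weakly increasing and diagonals are weakly decreasing; that is, if $u$ and $v$ are consecutive columns, then $u_{j+1}\le v_j\le u_j$ for all $1\le j\le \ell(v)$. Number the columns $0,1,\dots,r$ from left to right. Every entry of column $0$ has weight $1$. An entry $\beta$ of column $i\ge 1$ with left neighbour $\alpha$ and upper left neighbour $\gamma$ (so $\alpha\le\beta\le\gamma$) has weight $x_i/y_\beta-1$ if $\alpha=\beta$, weight $x_i/y_\beta$ if $\alpha<\beta<\gamma$, and weight $1$ if $\beta=\gamma$. The weight of a staircase is the product of the weights of its entries. For a column $v$, the partition function $F(n,v)$ is the sum of the weights of all staircases with first column $[n,n-1,\dots,1]$ and last column $v$. **Schubert polynomials.** For $m\ge 0$, the Schubert polynomials $\mathbb Y_v(\mathbf x,\mathbf y)\in\mathbb Z[x_1,\dots,x_m,y_1,y_2,\dots]$, indexed by codes $v\in\mathbb N^m$, are the polynomials obtained from the dominant ones $$\mathbb Y_v(\mathbf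 x,\mathbf y)=\prod_{i}\prod_{j=1}^{v_i}(x_i-y_j)\qquad(v_1\ge v_2\ge\cdots\ge v_m)$$ by the divided differences $\partial_i f=\dfrac{f-f^{s_i}}{x_i-x_{i+1}}$, where $f^{s_i}$ is the image of $f$ under the exchange of $x_i$ and $x_{i+1}$, through the rule $$\mathbb Y_{[\dots,v_{i+1},\,v_i-1,\dots]}=\partial_i\,\mathbb Y_{[\dots,v_i,\,v_{i+1},\dots]}\qquad\text{if } v_i>v_{i+1}.$$ **Statement.** Let $n,b$ be positive integers with $b\le n$, let $\rho=[n-2,\dots,1,0]$ and $\mathbf x=[x_1,\dots,x_{n-1}]$. The Schubert polynomial $\mathbb Y_{[0^{b-1},1^{n-b}]}(\mathbf x,\mathbf y)$ is well defined (it exists and does not depend on the chosen dominant polynomial and divided differences), and $$F(n,[b])=x^{\rho}\,y^{-\rho}\,y^{-[0^{b-1},1^{n-b}]}\;\mathbb Y_{[0^{b-1},1^{n-b}]}(\mathbf x,\mathbf y),$$ where $z^{[e_1,e_2,\dots]}=z_1^{e_1}z_2^{e_2}\cdots$. The identity holds for all values of the $x_i$ and all nonzero values of $y_1,\dots,y_{n-1}$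 in any field, in particular as an identity of rational functions in indeterminates. Moreover, at $\mathbf y=\mathbf 0$ the polynomial $\mathbb Y_{[0^{b-1},1^{n-b}]}(\mathbf x,\mathbf y)$ specializes to the elementary symmetric function $e_{n-b}(x_1,\dots,x_{n-1})$. -/

import Mathlib

namespace Staircases

/-! Columns, staircases and their weights -/

/-- `v` may stand immediately to the right of the column `u` in a staircase. Columns are listed from
top to bottom and aligned at their bottoms, so `u[j+1]` is the left neighbour of `v[j]`, and `u[j]` is
the neighbour of `v[j]` on its upper left. -/
def Adjacent (u v : List ℕ) : Prop :=
  u.length = v.length + 1 ∧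
    ∀ j < v.length, u.getD (j + 1) 0 ≤ v.getD j 0 ∧ v.getD j 0 ≤ u.getD j 0

/-- A staircase, as the list of its columns from left to right: every column is strictly decreasing
(from top to bottom), the lengths drop by one at each step, rows are weakly increasing and diagonals
are weakly decreasing. -/
def IsStaircase (t : List (List ℕ)) : Prop :=
  t ≠ [] ∧ (∀ u ∈ t, u.SortedGT) ∧ t.IsChain Adjacent

/-- The set `E(u,v)` of staircases with first column `u` and last column `v`. -/
def staircases (u v : List ℕ) : Set (List (List ℕ)) :=
  {t | IsStaircase t ∧ t.head? = some u ∧ t.getLast? = some v}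

theorem bounds_of_isChain (L B : ℕ) (t : List (List ℕ)) :
    t.IsChain Adjacent → (∀ u ∈ t.head?, u.length ≤ L ∧ ∀ a ∈ u, a ≤ B) →
      t.length ≤ L + 1 ∧ ∀ u ∈ t, u.length ≤ L ∧ ∀ a ∈ u, a ≤ B := by
  induction t generalizing L with
  | nil => simp
  | cons u t ih =>
    intro hc hu
    have hu' : u.length ≤ L ∧ ∀ a ∈ u, a ≤ B := hu u (by simp)
    cases t with
    | nil => simpa using hu'
    | cons v t =>
      rw [List.isChain_cons_cons] at hc
      obtain ⟨⟨hl, hj⟩, hc⟩ := hc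
      have key := ih (L - 1) hc (by
        intro w hw
        simp only [List.head?_cons, Option.mem_def, Option.some.injEq] at hw
        subst hw
        refine ⟨by omega, fun a ha => ?_⟩
        obtain ⟨j, hjl, rfl⟩ := List.getElem_of_mem ha
        have h2 := (hj j hjl).2
        have hju : j < u.length := by omega
        rw [List.getD_eq_getElem _ _ hjl, List.getD_eq_getElem _ _ hju] at h2
        exact h2.trans (hu'.2 _ (List.getElem_mem hju)))
      refine ⟨?_, ?_⟩
      · have := key.1
        simp only [List.length_cons] at this ⊢
        omega
      · intro w hw
        rcases List.mem_cons.1 hw with rfl | hw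
        · exact hu'
        · exact ⟨(key.2 w hw).1.trans (Nat.sub_le _ _), (key.2 w hw).2⟩

theorem finite_bounded_lists {α : Type} (S : Set α) (hS : S.Finite) (L : ℕ) :
    {l : List α | l.length ≤ L ∧ ∀ a ∈ l, a ∈ S}.Finite := by
  have := hS.to_subtype
  refine ((List.finite_length_le S L).image (List.map Subtype.val)).subset ?_
  rintro l ⟨hl, hm⟩
  refine ⟨l.attach.map fun a => ⟨a.1, hm a.1 a.2⟩, by simpa using hl, ?_⟩
  simp

theorem staircases_finite (u v : List ℕ) : (staircases u v).Finite := by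
  have h1 : {w : List ℕ | w.length ≤ u.length ∧ ∀ a ∈ w, a ∈ Set.Iic u.sum}.Finite :=
    finite_bounded_lists _ (Set.finite_Iic _) _
  refine (finite_bounded_lists _ h1 (u.length + 1)).subset ?_
  rintro t ⟨⟨-, -, hc⟩, hh, -⟩
  refine bounds_of_isChain u.length u.sum t hc ?_
  intro w hw
  rw [hh] at hw
  simp only [Option.mem_def, Option.some.injEq] at hw
  subst hw
  exact ⟨le_rfl, fun a ha => List.le_sum_of_mem ha⟩

/-- The weight of an entry `b` with left neighbour `a` and upper left neighbour `c`, the variable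
attached to its column being `x`. -/
noncomputable def entryWeight {K : Type*} [Field K] (x : K) (y : ℕ → K) (a b c : ℕ) : K :=
  if a = b then x / y b - 1 else if a < b ∧ b < c then x / y b else 1

/-- The weight of a staircase: the product of the weights of the entries outside the first column.
The first column has no variable; the columns after it have the variables `x 1, x 2, …`. -/
noncomputable def staircaseWeight {K : Type*} [Field K] (x y : ℕ → K) (t : List (List ℕ)) : K :=
  ∏ i ∈ Finset.range (t.length - 1), ∏ j ∈ Finset.range (t.getD (i + 1) []).length,
    entryWeight (x (i + 1)) y ((t.getD i []).getD (j + 1) 0) ((t.getD (i + 1) []).getD j 0)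
      ((t.getD i []).getD j 0)

/-- The partition function `F(u,v)`: the sum of the weights of the staircases in `E(u,v)`. -/
noncomputable def partitionFunction {K : Type*} [Field K] (x y : ℕ → K) (u v : List ℕ) : K :=
  ∑ t ∈ (staircases_finite u v).toFinset, staircaseWeight x y t

/-- The column `[n, …, 2, 1]`. -/
def fullColumn (n : ℕ) : List ℕ := (List.range' 1 n).reverse

/-! Schubert polynomials in the two alphabets `x 1, x 2, …` and `y 1, y 2, …` -/

/-- Polynomials over `ℤ` in the variables `xv i` and `yv j` (only `i, j ≥ 1` are used). -/
abbrev Poly : Type := MvPolynomial (ℕ ⊕ ℕ) ℤ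

noncomputable def xv (i : ℕ) : Poly := MvPolynomial.X (Sum.inl i)

noncomputable def yv (j : ℕ) : Poly := MvPolynomial.X (Sum.inr j)

/-- The image of a polynomial under the exchange of `xv i` and `xv (i+1)`. -/
noncomputable def exchange (i : ℕ) (P : Poly) : Poly :=
  MvPolynomial.rename (Equiv.swap (Sum.inl i) (Sum.inl (i + 1))) P

/-- `Q` is the Newton divided difference `∂ᵢ P = (P - P^{sᵢ}) / (xᵢ - xᵢ₊₁)`. -/
def IsDividedDifference (i : ℕ) (P Q : Poly) : Prop :=
  (xv i - xv (i + 1)) * Q = P - exchange i P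

/-- The dominant polynomial `∏ᵢ ∏_{1 ≤ j ≤ vᵢ} (xᵢ - yⱼ)`. -/
noncomputable def dominantPoly (v : List ℕ) : Poly :=
  ∏ i ∈ Finset.range v.length, ∏ j ∈ Finset.Icc 1 (v.getD i 0), (xv (i + 1) - yv j)

/-- `IsSchubert v P`: the polynomial `P` is obtained as a Schubert polynomial `𝕐_v(x,y)` with code
`v`. Schubert polynomials are the images of the dominant ones under divided differences, where
`∂ᵢ 𝕏_σ = 𝕏_{σ sᵢ}` if `σᵢ > σᵢ₊₁`. In terms of the code `v` of `σ`, the condition `σᵢ > σᵢ₊₁` reads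
`vᵢ > vᵢ₊₁`, and the code of `σ sᵢ` is `v` with `vᵢ, vᵢ₊₁` replaced by `vᵢ₊₁, vᵢ - 1`. -/
inductive IsSchubert : List ℕ → Poly → Prop
  | dominant (v : List ℕ) (hv : v.SortedGE) : IsSchubert v (dominantPoly v)
  | divided (p s : List ℕ) (a b : ℕ) (P Q : Poly) (hab : b < a)
      (hP : IsSchubert (p ++ a :: b :: s) P) (hQ : IsDividedDifference (p.length + 1) P Q) :
      IsSchubert (p ++ b :: (a - 1) :: s) Q

/-- The monomial `z₁^{e₁} z₂^{e₂} ⋯`. -/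
noncomputable def monom {K : Type*} [Field K] (z : ℕ → K) (e : List ℕ) : K :=
  ∏ i ∈ Finset.range e.length, z (i + 1) ^ e.getD i 0

/-- `ρ = [n-2, …, 1, 0]`. -/
def rho (n : ℕ) : List ℕ := (List.range (n - 1)).reverse

/-- The code `[0^{b-1}, 1^{n-b}]`. -/
def zeroOneCode (n b : ℕ) : List ℕ := List.replicate (b - 1) 0 ++ List.replicate (n - b) 1

end Staircases

namespace Staircases

/-! Divided differences -/

/-! Both sides are computed independently and meet in `doubleElem`, the double elementary symmetric
polynomial defined by E(z::xs, b+1) = E(xs, b) + (z - y_{b+1}) E(xs, b+1).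

Schubert side. Well-definedness (`existsUnique_isSchubert`) goes by downward induction on the sum of
the code: two last steps ∂_i, ∂_j leading to the same code are reconciled by commutation or by the
braid relation. The required polynomial is reached from a dominant one by pushing entries b to the
right through zeros; a telescoping expansion with symmetric coefficients makes these divided
differences computable (`isSchubert_doubleElem_aux`).

Staircase side. Let T (`integ`) satisfy Tφ(u) - Tφ(u+1) = φ(u)/y_u. The weights are such that (xT -
1)φ(α) - (xT - 1)φ(γ) is the weighted sum of φ over [α,γ] (`step_sub_step`). So subtracting
consecutive rows of a determinant adds one column to the staircases, and F(u,[b]) is the determinant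
whose columns are the functions ∏_{l≤i}(x_l T - 1) 1, followed by ∏_l(x_l T - 1) δ_b, evaluated at
the entries of u (`partitionFunction_eq_det`). For u = [n,…,1] column operations reduce this to a
monomial times (D^{n-1} ∏_l(x_l T - 1) δ_b)(1), where D (`diffOp`) inverts T (`det_columns`). This
value is (∏_l(x_l - D) δ_b)(1), and Dδ_b = y_b δ_b - y_{b-1} δ_{b-1} turns it into the recursion of
E (`rootPoly_single_succ`). -/

theorem exchange_add (i : ℕ) (P Q : Poly) : exchange i (P + Q) = exchange i P + exchange i Q :=
  map_add _ _ _

theorem exchange_sub (i : ℕ) (P Q : Poly) : exchange i (P - Q) = exchange i P - exchange i Q :=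
  map_sub _ _ _

theorem exchange_mul (i : ℕ) (P Q : Poly) : exchange i (P * Q) = exchange i P * exchange i Q :=
  map_mul _ _ _

theorem exchange_one (i : ℕ) : exchange i 1 = 1 := map_one _

theorem exchange_zero (i : ℕ) : exchange i 0 = 0 := map_zero _

theorem exchange_prod {ι : Type*} (i : ℕ) (s : Finset ι) (f : ι → Poly) :
    exchange i (∏ j ∈ s, f j) = ∏ j ∈ s, exchange i (f j) := map_prod _ _ _

theorem exchange_exchange (i : ℕ) (P : Poly) : exchange i (exchange i P) = P := by
  simp [exchange, MvPolynomial.rename_rename, ← Equiv.coe_trans]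

theorem exchange_yv (i j : ℕ) : exchange i (yv j) = yv j := by
  simp [exchange, yv, Equiv.swap_apply_def]

theorem exchange_xv_left (i : ℕ) : exchange i (xv i) = xv (i + 1) := by
  simp [exchange, xv]

theorem exchange_xv_right (i : ℕ) : exchange i (xv (i + 1)) = xv i := by
  simp [exchange, xv]

theorem exchange_xv_of_ne {i k : ℕ} (h1 : k ≠ i) (h2 : k ≠ i + 1) : exchange i (xv k) = xv k := by
  simp [exchange, xv, Equiv.swap_apply_def, h1, h2]

theorem exchange_comm {i j : ℕ} (hij : i + 1 < j) (P : Poly) :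
    exchange i (exchange j P) = exchange j (exchange i P) := by
  have h := (Equiv.Perm.disjoint_swap_swap (x := (Sum.inl i : ℕ ⊕ ℕ)) (y := Sum.inl (i + 1))
    (z := Sum.inl j) (t := Sum.inl (j + 1)) (by simp; omega)).commute.eq
  simp only [exchange, MvPolynomial.rename_rename, ← Equiv.Perm.coe_mul, h]

theorem exchange_braid (i : ℕ) (P : Poly) :
    exchange i (exchange (i + 1) (exchange i P)) =
      exchange (i + 1) (exchange i (exchange (i + 1) P)) := by
  have h1 := Equiv.swap_mul_swap_mul_swap (x := (Sum.inl i : ℕ ⊕ ℕ)) (y := Sum.inl (i + 1))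
    (z := Sum.inl (i + 1 + 1)) (by simp) (by simp; omega)
  have h2 := Equiv.swap_mul_swap_mul_swap (x := (Sum.inl (i + 1 + 1) : ℕ ⊕ ℕ))
    (y := Sum.inl (i + 1)) (z := Sum.inl i) (by simp) (by simp; omega)
  rw [Equiv.swap_comm (Sum.inl (i + 1)) (Sum.inl i),
    Equiv.swap_comm (Sum.inl (i + 1 + 1)) (Sum.inl (i + 1))] at h2
  rw [Equiv.swap_comm _ (Sum.inl i)] at h1
  simp only [exchange, MvPolynomial.rename_rename, ← Equiv.Perm.coe_mul, ← mul_assoc, h1, h2]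

theorem xv_sub_xv_ne_zero {i j : ℕ} (h : i ≠ j) : xv i - xv j ≠ 0 := by
  rw [sub_ne_zero]
  intro h'
  exact h (Sum.inl_injective (MvPolynomial.X_injective h'))

/-- Modulo x_i - x_{i+1} the two exchanged variables coincide, so the exchange induces the identity
on the quotient. -/
theorem exists_isDividedDifference (i : ℕ) (P : Poly) : ∃ Q, IsDividedDifference i P Q := by
  have h : (xv i - xv (i + 1)) ∣ P - exchange i P := by
    rw [← Ideal.mem_span_singleton, ← Ideal.Quotient.mk_eq_mk_iff_sub_mem]
    set I := Ideal.span {xv i - xv (i + 1)}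
    have hx : Ideal.Quotient.mk I (xv i) = Ideal.Quotient.mk I (xv (i + 1)) := by
      rw [Ideal.Quotient.mk_eq_mk_iff_sub_mem]
      exact Ideal.mem_span_singleton_self _
    have key : Ideal.Quotient.mkₐ ℤ I =
        (Ideal.Quotient.mkₐ ℤ I).comp
          (MvPolynomial.rename (Equiv.swap (Sum.inl i) (Sum.inl (i + 1)))) := by
      refine MvPolynomial.algHom_ext fun z => ?_
      simp only [AlgHom.comp_apply, MvPolynomial.rename_X, Equiv.swap_apply_def]
      split_ifs with h1 h2
      · subst h1; exact hx
      · subst h2; exact hx.symm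
      · rfl
    exact DFunLike.congr_fun key P
  obtain ⟨Q, hQ⟩ := h
  exact ⟨Q, hQ.symm⟩

theorem IsDividedDifference.unique {i : ℕ} {P Q Q' : Poly} (h : IsDividedDifference i P Q)
    (h' : IsDividedDifference i P Q') : Q = Q' :=
  mul_left_cancel₀ (xv_sub_xv_ne_zero (Nat.succ_ne_self i).symm) (h.trans h'.symm)

/-- Multiplied by (x_i - x_{i+1})(x_j - x_{j+1}), both results become R - s_i R - s_j R + s_i s_j R.
-/
theorem IsDividedDifference.comm {i j : ℕ} (hij : i + 1 < j) {R A B A' B' : Poly}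
    (h1 : IsDividedDifference i R A) (h2 : IsDividedDifference j A B)
    (h1' : IsDividedDifference j R A') (h2' : IsDividedDifference i A' B') : B = B' := by
  have e1 := congrArg (exchange j) h1
  have e1' := congrArg (exchange i) h1'
  unfold IsDividedDifference at *
  simp only [exchange_mul, exchange_sub] at e1 e1'
  rw [exchange_xv_of_ne (by omega) (by omega), exchange_xv_of_ne (by omega) (by omega)] at e1 e1'
  rw [exchange_comm hij] at e1'
  refine mul_left_cancel₀ (mul_ne_zero (xv_sub_xv_ne_zero (Nat.succ_ne_self i).symm)
    (xv_sub_xv_ne_zero (Nat.succ_ne_self j).symm)) ?_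
  linear_combination (xv i - xv (i + 1)) * h2 - (xv j - xv (j + 1)) * h2' + h1 - h1' - e1 + e1'

/-- Multiplied by the Vandermonde product of the three variables, both results become the
antisymmetrization of R over S_3. -/
theorem IsDividedDifference.braid {i : ℕ} {R A B C A' B' C' : Poly}
    (h1 : IsDividedDifference i R A) (h2 : IsDividedDifference (i + 1) A B)
    (h3 : IsDividedDifference i B C) (h1' : IsDividedDifference (i + 1) R A')
    (h2' : IsDividedDifference i A' B') (h3' : IsDividedDifference (i + 1) B' C') : C = C' := by
  have hs0 : exchange i (xv i) = xv (i + 1) := exchange_xv_left i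
  have hs1 : exchange i (xv (i + 1)) = xv i := exchange_xv_right i
  have hs2 : exchange i (xv (i + 1 + 1)) = xv (i + 1 + 1) :=
    exchange_xv_of_ne (by omega) (by omega)
  have ht0 : exchange (i + 1) (xv i) = xv i := exchange_xv_of_ne (by omega) (by omega)
  have ht1 : exchange (i + 1) (xv (i + 1)) = xv (i + 1 + 1) := exchange_xv_left _
  have ht2 : exchange (i + 1) (xv (i + 1 + 1)) = xv (i + 1) := exchange_xv_right _
  have e1 := congrArg (exchange (i + 1)) h1
  have e2 := congrArg (exchange i) h2
  have e3 := congrArg (exchange i) h1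
  have e4 := congrArg (exchange i) e1
  have e1' := congrArg (exchange i) h1'
  have e2' := congrArg (exchange (i + 1)) h2'
  have e3' := congrArg (exchange (i + 1)) h1'
  have e4' := congrArg (exchange (i + 1)) e1'
  unfold IsDividedDifference at *
  simp only [exchange_mul, exchange_sub, hs0, hs1, hs2, ht0, ht1, ht2, exchange_exchange] at *
  rw [← exchange_braid] at e4'
  have n1 := xv_sub_xv_ne_zero (show i ≠ i + 1 by omega)
  have n2 := xv_sub_xv_ne_zero (show i + 1 ≠ i + 1 + 1 by omega)
  have n3 := xv_sub_xv_ne_zero (show i ≠ i + 1 + 1 by omega)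
  generalize xv i = a at *
  generalize xv (i + 1) = b at *
  generalize xv (i + 1 + 1) = c at *
  have k1 : (a - b) * (b - c) * (a - c) * C = R - exchange i R - exchange (i + 1) R
      + exchange (i + 1) (exchange i R) + exchange i (exchange (i + 1) R)
      - exchange i (exchange (i + 1) (exchange i R)) := by
    -- The extra factor a - b is needed because the symmetry of A under the exchange is only
    -- available in the form (a - b) A = R - s_i R.
    refine mul_left_cancel₀ n1 ?_
    linear_combination (a - b) * (b - c) * (a - c) * h3 + (a - b) * (a - c) * h2
      + (a - c) * h1 - (a - b) * e1 - (a - b) * (b - c) * e2 + (b - c) * e3 + (a - b) * e4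
  have k2 : (a - b) * (b - c) * (a - c) * C' = R - exchange i R - exchange (i + 1) R
      + exchange (i + 1) (exchange i R) + exchange i (exchange (i + 1) R)
      - exchange i (exchange (i + 1) (exchange i R)) := by
    refine mul_left_cancel₀ n2 ?_
    linear_combination (a - b) * (b - c) * (a - c) * h3' + (b - c) * (a - c) * h2'
      + (a - c) * h1' - (b - c) * e1' - (b - c) * (a - b) * e2' + (a - b) * e3' + (b - c) * e4'
  exact mul_left_cancel₀ (mul_ne_zero (mul_ne_zero n1 n2) n3) (k1.trans k2.symm)

/-! Products of linear factors -/

/-- The product `(x_k - y_1) ⋯ (x_k - y_d)`. -/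
noncomputable def linProd (k d : ℕ) : Poly := ∏ j ∈ Finset.Icc 1 d, (xv k - yv j)

theorem linProd_zero (k : ℕ) : linProd k 0 = 1 := by simp [linProd]

theorem linProd_succ (k d : ℕ) : linProd k (d + 1) = linProd k d * (xv k - yv (d + 1)) := by
  simp [linProd, Finset.prod_Icc_succ_top]

theorem exchange_linProd_left (i d : ℕ) : exchange i (linProd i d) = linProd (i + 1) d := by
  simp [linProd, exchange_prod, exchange_sub, exchange_yv, exchange_xv_left]

theorem exchange_linProd_right (i d : ℕ) : exchange i (linProd (i + 1) d) = linProd i d := by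
  simp [linProd, exchange_prod, exchange_sub, exchange_yv, exchange_xv_right]

theorem exchange_linProd_of_ne {i k : ℕ} (h1 : k ≠ i) (h2 : k ≠ i + 1) (d : ℕ) :
    exchange i (linProd k d) = linProd k d := by
  simp [linProd, exchange_prod, exchange_sub, exchange_yv, exchange_xv_of_ne h1 h2]

/-- The dominant product of the code `v`, in the variables `x_{k+1}, x_{k+2}, …`. -/
noncomputable def dominantFrom : ℕ → List ℕ → Poly
  | _, [] => 1
  | k, a :: v => linProd (k + 1) a * dominantFrom (k + 1) v

theorem dominantFrom_append (k : ℕ) (p s : List ℕ) :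
    dominantFrom k (p ++ s) = dominantFrom k p * dominantFrom (k + p.length) s := by
  induction p generalizing k with
  | nil => simp [dominantFrom]
  | cons a p ih => simp [dominantFrom, ih, mul_assoc, add_assoc, add_comm 1]

theorem dominantFrom_eq_prod (k : ℕ) (v : List ℕ) :
    dominantFrom k v = ∏ i ∈ Finset.range v.length, linProd (k + i + 1) (v.getD i 0) := by
  induction v generalizing k with
  | nil => simp [dominantFrom]
  | cons a v ih =>
    rw [List.length_cons, Finset.prod_range_succ', dominantFrom, ih, mul_comm]
    simp [add_comm, add_left_comm]

theorem dominantPoly_eq (v : List ℕ) : dominantPoly v = dominantFrom 0 v := by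
  simp [dominantFrom_eq_prod, dominantPoly, linProd]

theorem exchange_dominantFrom_of_le {i k : ℕ} (h : i + 1 ≤ k) (v : List ℕ) : exchange i (dominantFrom k v) = dominantFrom k v := by
  induction v generalizing k with
  | nil => simp [dominantFrom, exchange_one]
  | cons a v ih =>
    rw [dominantFrom, exchange_mul, exchange_linProd_of_ne (by omega) (by omega),
      ih (by omega)]

theorem exchange_dominantFrom_of_lt {i k : ℕ} (v : List ℕ) (h : k + v.length < i) :
    exchange i (dominantFrom k v) = dominantFrom k v := by
  induction v generalizing k with
  | nil => simp [dominantFrom, exchange_one]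
  | cons a v ih =>
    simp only [List.length_cons] at h
    rw [dominantFrom, exchange_mul, exchange_linProd_of_ne (by omega) (by omega), ih (by omega)]

/-- With i = `p.length + 1`, the first product is the second, symmetric in x_i and x_{i+1}, times
x_i - y_{c+1}, and ∂_i of that factor is 1. -/
theorem isDividedDifference_dominantFrom (p s : List ℕ) (c : ℕ) :
    IsDividedDifference (p.length + 1) (dominantFrom 0 (p ++ (c + 1) :: c :: s))
      (dominantFrom 0 (p ++ c :: c :: s)) := by
  simp only [IsDividedDifference, dominantFrom_append, dominantFrom, exchange_mul, zero_add,
    exchange_dominantFrom_of_lt p (show 0 + p.length < p.length + 1 by omega),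
    exchange_linProd_left, exchange_linProd_right,
    exchange_dominantFrom_of_le (le_refl (p.length + 1 + 1))]
  simp only [linProd_succ]
  ring

/-! Codes bounded by a staircase -/

/-- The entries of `v`, increased by their positions counted from `k`, are at most `N`. -/
def BoundedFrom (N : ℕ) : ℕ → List ℕ → Prop
  | _, [] => True
  | k, a :: v => a + k ≤ N ∧ BoundedFrom N (k + 1) v

theorem boundedFrom_append (N k : ℕ) (p s : List ℕ) :
    BoundedFrom N k (p ++ s) ↔ BoundedFrom N k p ∧ BoundedFrom N (k + p.length) s := by
  induction p generalizing k with
  | nil => simp [BoundedFrom]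
  | cons a p ih => simp [BoundedFrom, ih, and_assoc, add_assoc, add_comm 1]

/-- When d grows by one it also moves one place to the left, so undoing a divided difference keeps
the bound. This confines the downward induction to codes of bounded sum. -/
theorem BoundedFrom.raise {N k c d : ℕ} {p s : List ℕ} (h : BoundedFrom N k (p ++ c :: d :: s))
    (hcd : c ≤ d) : BoundedFrom N k (p ++ (d + 1) :: c :: s) := by
  rw [boundedFrom_append] at h ⊢
  obtain ⟨h1, h2, h3, h4⟩ := h
  exact ⟨h1, by omega, by omega, h4⟩

theorem BoundedFrom.sum_le {N k : ℕ} {v : List ℕ} (h : BoundedFrom N k v) :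
    v.sum ≤ v.length * N := by
  induction v generalizing k with
  | nil => simp
  | cons a v ih =>
    have := ih h.2
    have := h.1
    simp only [List.sum_cons, List.length_cons, Nat.succ_mul]
    omega

theorem exists_boundedFrom (k : ℕ) (v : List ℕ) : ∃ N₀, ∀ N ≥ N₀, BoundedFrom N k v := by
  induction v generalizing k with
  | nil => exact ⟨0, fun _ _ => trivial⟩
  | cons a v ih =>
    obtain ⟨N₀, h⟩ := ih (k + 1)
    exact ⟨max N₀ (a + k), fun N hN => ⟨by omega, h N (by omega)⟩⟩

/-! Existence and uniqueness of Schubert polynomials -/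

/-- `P` is a divided difference of a Schubert polynomial, with code `v`. -/
def IsDivided (v : List ℕ) (P : Poly) : Prop :=
  ∃ p c d s P₀, v = p ++ c :: d :: s ∧ c ≤ d ∧ IsSchubert (p ++ (d + 1) :: c :: s) P₀ ∧
    IsDividedDifference (p.length + 1) P₀ P

theorem IsSchubert.lower {p s : List ℕ} {c d : ℕ} {P Q : Poly} (hcd : c ≤ d)
    (hP : IsSchubert (p ++ (d + 1) :: c :: s) P)
    (hQ : IsDividedDifference (p.length + 1) P Q) : IsSchubert (p ++ c :: d :: s) Q :=
  IsSchubert.divided p s (d + 1) c P Q (by omega) hP hQ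

theorem IsDivided.isSchubert {v : List ℕ} {P : Poly} (h : IsDivided v P) : IsSchubert v P := by
  obtain ⟨p, c, d, s, P₀, rfl, hcd, h, hP⟩ := h
  exact h.lower hcd hP

theorem isSchubert_cases {v : List ℕ} {P : Poly} (h : IsSchubert v P) :
    v.SortedGE ∧ P = dominantPoly v ∨ IsDivided v P := by
  cases h with
  | dominant v hv => exact Or.inl ⟨hv, rfl⟩
  | divided p s a b P Q hab hP hQ =>
    refine Or.inr ⟨p, b, a - 1, s, P, rfl, by omega, ?_, hQ⟩
    rwa [Nat.sub_add_cancel (by omega)]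

theorem exists_ascent {v : List ℕ} (h : ¬ v.SortedGE) :
    ∃ p c d s, v = p ++ c :: d :: s ∧ c < d := by
  rw [List.sortedGE_iff_isChain] at h
  induction v with
  | nil => simp at h
  | cons a v ih =>
    cases v with
    | nil => simp at h
    | cons b v =>
      by_cases hab : a < b
      · exact ⟨[], a, b, v, rfl, hab⟩
      · rw [List.isChain_cons_cons] at h
        obtain ⟨p, c, d, s, e, hcd⟩ := ih (fun h' => h ⟨by omega, h'⟩)
        exact ⟨a :: p, c, d, s, by rw [e, List.cons_append], hcd⟩

/-- Raise the leftmost entry of the block of entries equal to c. -/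
theorem exists_dominant_raise {p s : List ℕ} {c : ℕ} (h : (p ++ c :: c :: s).SortedGE) :
    ∃ p' s', p ++ c :: c :: s = p' ++ c :: c :: s' ∧ (p' ++ (c + 1) :: c :: s').SortedGE := by
  induction p using List.reverseRecOn generalizing s with
  | nil =>
    refine ⟨[], s, rfl, ?_⟩
    rw [List.sortedGE_iff_isChain] at h ⊢
    simp only [List.nil_append, List.isChain_cons_cons] at h ⊢
    exact ⟨by omega, h.2⟩
  | append_singleton p e ih =>
    by_cases hec : e = c
    · subst hec
      obtain ⟨p', s', h1, h2⟩ := ih (s := e :: s) (by simpa using h)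
      exact ⟨p', s', by simpa using h1, h2⟩
    · refine ⟨p ++ [e], s, rfl, ?_⟩
      rw [List.sortedGE_iff_isChain] at h ⊢
      simp only [List.append_assoc, List.singleton_append, List.isChain_append,
        List.isChain_cons_cons, List.head?_cons] at h ⊢
      obtain ⟨h1, ⟨h2, h3, h4⟩, h5⟩ := h
      exact ⟨h1, ⟨by omega, by omega, h4⟩, h5⟩

/-- Both derivations are extended one level up to a common ancestor R. The intermediate polynomials
are identified by the induction hypothesis, and the relations between divided differences conclude.
-/
theorem IsDivided.unique {N : ℕ} {v : List ℕ} (hv : BoundedFrom N 0 v)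
    (ih : ∀ w : List ℕ, BoundedFrom N 0 w → w.length = v.length → v.sum < w.sum →
      ∃! P, IsSchubert w P) {P Q : Poly} (hP : IsDivided v P) (hQ : IsDivided v Q) : P = Q := by
  obtain ⟨p, c, d, s, P₀, e, hcd, hP₀, hP⟩ := hP
  obtain ⟨p', c', d', s', Q₀, eq', hcd', hQ₀, hQ⟩ := hQ
  wlog hpp : p.length ≤ p'.length generalizing p p' c c' d d' s s' P₀ Q₀ P Q
  · exact (this p' c' d' s' Q₀ eq' hcd' hQ₀ hQ p c d s P₀ e hcd hP₀ hP (by omega)).symm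
  subst e
  have hv1 := hv.raise hcd
  have u1 := ih _ hv1 (by simp) (by simp; omega)
  rw [List.append_eq_append_iff] at eq'
  obtain ⟨as, rfl, e'⟩ : ∃ as, p' = p ++ as ∧ c :: d :: s = as ++ c' :: d' :: s' := by
    rcases eq' with h | ⟨bs, rfl, h⟩
    · exact h
    · have : bs = [] := by
        simp only [List.length_append] at hpp
        exact List.length_eq_zero_iff.1 (by omega)
      subst this
      exact ⟨[], by simp, by simpa using h.symm⟩
  -- `as` separates the positions of the two divided differences. If it is empty they are the same;
  -- if it has one entry they overlap, and the braid relation applies with R of code (d'+2, d+1, c)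
  -- at these three places; otherwise they commute.
  rcases as with _ | ⟨a, _ | ⟨b, q⟩⟩
  · simp only [List.nil_append, List.cons.injEq] at e'
    obtain ⟨rfl, rfl, rfl⟩ := e'
    simp only [List.append_nil] at hQ₀ hQ
    rw [u1.unique hQ₀ hP₀] at hQ
    exact hP.unique hQ
  · simp only [List.cons_append, List.nil_append, List.cons.injEq] at e'
    obtain ⟨rfl, rfl, rfl⟩ := e'
    have hvm : BoundedFrom N 0 ((p ++ [c]) ++ d :: d' :: s') := by simpa using hv
    have hv2 := hvm.raise hcd'
    have hv1' : BoundedFrom N 0 ((p ++ [d + 1]) ++ c :: d' :: s') := by simpa using hv1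
    have hv1b := hv1'.raise (by omega)
    simp only [List.append_assoc, List.singleton_append] at hv2 hv1b hQ₀
    have hv3 := hv1b.raise (by omega)
    obtain ⟨R, hR, -⟩ := ih _ hv3 (by simp) (by simp; omega)
    obtain ⟨A, hA⟩ := exists_isDividedDifference (p.length + 1) R
    obtain ⟨B, hB⟩ := exists_isDividedDifference (p.length + 1 + 1) A
    obtain ⟨A', hA'⟩ := exists_isDividedDifference (p.length + 1 + 1) R
    obtain ⟨B', hB'⟩ := exists_isDividedDifference (p.length + 1) A'
    have sA := hR.lower (by omega) hA
    have sA1 : IsSchubert ((p ++ [d + 1]) ++ (d' + 1) :: c :: s') A := by simpa using sA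
    have sB := sA1.lower (by omega) (Q := B) (by simpa using hB)
    have hR1 : IsSchubert ((p ++ [d' + 1 + 1]) ++ (d + 1) :: c :: s') R := by simpa using hR
    have sA' := hR1.lower (by omega) (Q := A') (by simpa using hA')
    have sA1' : IsSchubert (p ++ (d' + 1 + 1) :: c :: d :: s') A' := by simpa using sA'
    have sB' := sA1'.lower (by omega) hB'
    have e1 : P₀ = B := u1.unique hP₀ (by simpa using sB)
    have e2 : Q₀ = B' := (ih _ hv2 (by simp) (by simp; omega)).unique hQ₀ sB'
    subst e1 e2
    exact IsDividedDifference.braid hA hB hP hA' hB' (by simpa using hQ)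
  · simp only [List.cons_append, List.cons.injEq] at e'
    obtain ⟨rfl, rfl, rfl⟩ := e'
    have hvm : BoundedFrom N 0 ((p ++ c :: d :: q) ++ c' :: d' :: s') := by simpa using hv
    have hv2 := hvm.raise hcd'
    have hv1' : BoundedFrom N 0 ((p ++ (d + 1) :: c :: q) ++ c' :: d' :: s') := by simpa using hv1
    have hv3 := hv1'.raise hcd'
    obtain ⟨R, hR, -⟩ := ih _ hv3 (by simp) (by simp; omega)
    obtain ⟨A, hA⟩ := exists_isDividedDifference ((p ++ c :: d :: q).length + 1) R
    obtain ⟨A', hA'⟩ := exists_isDividedDifference (p.length + 1) R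
    have sA := hR.lower hcd' (Q := A) (by simpa using hA)
    have hR1 : IsSchubert (p ++ (d + 1) :: c :: (q ++ (d' + 1) :: c' :: s')) R := by simpa using hR
    have sA' := hR1.lower hcd hA'
    have e1 : P₀ = A := u1.unique hP₀ (by simpa using sA)
    have e2 : Q₀ = A' := (ih _ hv2 (by simp) (by simp; omega)).unique hQ₀ (by simpa using sA')
    subst e1 e2
    exact (IsDividedDifference.comm (by simp) hA' hQ hA hP).symm

/-- Downward induction on the sum. A code that is not dominant has an ascent, hence a parent of
larger sum; a dominant one needs its product to agree with any divided difference giving the same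
code. -/
theorem existsUnique_isSchubert (v : List ℕ) : ∃! P, IsSchubert v P := by
  obtain ⟨N, hN⟩ := exists_boundedFrom 0 v
  have hv := hN N le_rfl
  clear hN
  induction hk : v.length * N - v.sum using Nat.strong_induction_on generalizing v with
  | _ k ih =>
    have ih' : ∀ w : List ℕ, BoundedFrom N 0 w → w.length = v.length → v.sum < w.sum →
        ∃! P, IsSchubert w P := by
      intro w hw hl hs
      refine ih _ ?_ w hw rfl
      have := hw.sum_le
      rw [hl] at this ⊢
      omega
    have hd : ∀ P Q, IsDivided v P → IsDivided v Q → P = Q := fun P Q => IsDivided.unique hv ih'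
    by_cases hs : v.SortedGE
    · have key : ∀ Q, IsDivided v Q → Q = dominantPoly v := by
        intro Q hQ
        refine hd _ _ hQ ?_
        obtain ⟨p, c, d, s, P₀, rfl, hcd, -⟩ := hQ
        -- Sortedness gives d ≤ c. The same code then also descends from a dominant code, where the
        -- divided difference is explicit.
        have hdc : d = c := by
          have := List.sortedGE_iff_isChain.1 hs
          simp only [List.isChain_append, List.isChain_cons_cons] at this
          omega
        subst hdc
        obtain ⟨p', s', e, h'⟩ := exists_dominant_raise hs
        refine ⟨p', d, d, s', _, e, le_rfl, IsSchubert.dominant _ h', ?_⟩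
        rw [e, dominantPoly_eq, dominantPoly_eq]
        exact isDividedDifference_dominantFrom p' s' d
      refine ⟨_, IsSchubert.dominant v hs, fun Q hQ => ?_⟩
      rcases isSchubert_cases hQ with ⟨-, h⟩ | h
      · exact h
      · exact key Q h
    · obtain ⟨p, c, d, s, e, hcd⟩ := exists_ascent hs
      obtain ⟨P₀, hP₀, -⟩ := ih' (p ++ (d + 1) :: c :: s) (BoundedFrom.raise (e ▸ hv) hcd.le)
        (by simp [e]) (by simp [e]; omega)
      obtain ⟨P, hP⟩ := exists_isDividedDifference (p.length + 1) P₀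
      have hdiv : IsDivided v P := ⟨p, c, d, s, P₀, e, hcd.le, hP₀, hP⟩
      refine ⟨P, hdiv.isSchubert, fun Q hQ => ?_⟩
      rcases isSchubert_cases hQ with ⟨h, -⟩ | h
      · exact absurd h hs
      · exact hd _ _ h hdiv

/-! Double elementary symmetric polynomials -/

/-- The double elementary symmetric polynomial of degree `m + 1 - b` in the `m` variables of the list
and in `y_1, …, y_b`. -/
def doubleElem {R : Type*} [CommRing R] (y : ℕ → R) : List R → ℕ → R
  | [], b => if b = 1 then 1 else 0
  | _ :: _, 0 => 0
  | z :: xs, b + 1 => doubleElem y xs b + (z - y (b + 1)) * doubleElem y xs (b + 1)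

theorem doubleElem_zero {R : Type*} [CommRing R] (y : ℕ → R) (xs : List R) :
    doubleElem y xs 0 = 0 := by
  cases xs <;> simp [doubleElem]

theorem doubleElem_of_lt {R : Type*} [CommRing R] (y : ℕ → R) (xs : List R) (b : ℕ)
    (h : xs.length + 1 < b) : doubleElem y xs b = 0 := by
  induction xs generalizing b with
  | nil => simp at h; simp [doubleElem]; omega
  | cons z xs ih =>
    simp only [List.length_cons] at h
    obtain ⟨b, rfl⟩ := Nat.exists_eq_succ_of_ne_zero (show b ≠ 0 by omega)
    rw [doubleElem, ih _ (by omega), ih _ (by omega)]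
    simp

theorem doubleElem_length_succ {R : Type*} [CommRing R] (y : ℕ → R) (xs : List R) :
    doubleElem y xs (xs.length + 1) = 1 := by
  induction xs with
  | nil => simp [doubleElem]
  | cons z xs ih =>
    rw [List.length_cons, doubleElem, ih, doubleElem_of_lt _ _ _ (by omega)]
    simp

/-- It suffices to swap two neighbours z and w: after two steps of the recursion the coefficients
are 1, z + w - y_{b+1} - y_{b+2} and (z - y_{b+2})(w - y_{b+2}). -/
theorem doubleElem_perm {R : Type*} [CommRing R] (y : ℕ → R) {xs xs' : List R} (h : xs.Perm xs') :
    doubleElem y xs = doubleElem y xs' := by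
  induction h with
  | nil => rfl
  | cons z _ ih =>
    funext b
    cases b <;> simp [doubleElem, ih]
  | swap z w xs =>
    funext b
    rcases b with _ | _ | b <;> simp only [doubleElem, doubleElem_zero] <;> ring
  | trans _ _ ih1 ih2 => exact ih1.trans ih2

theorem map_doubleElem {R S : Type*} [CommRing R] [CommRing S] (f : R →+* S) (y : ℕ → R)
    (xs : List R) (b : ℕ) :
    f (doubleElem y xs b) = doubleElem (fun j => f (y j)) (xs.map f) b := by
  induction xs generalizing b with
  | nil => simp [doubleElem, apply_ite f]
  | cons z xs ih => cases b <;> simp [doubleElem, ih]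

theorem doubleElem_zero_left {R : Type*} [CommRing R] (xs : List R) (b : ℕ) :
    doubleElem (fun _ => 0) xs (b + 1) =
      ((xs.map fun z => Polynomial.X + Polynomial.C z).prod).coeff b := by
  induction xs generalizing b with
  | nil => simp [doubleElem, Polynomial.coeff_one]
  | cons z xs ih =>
    rw [doubleElem, List.map_cons, List.prod_cons, add_mul, Polynomial.coeff_add,
      Polynomial.coeff_C_mul, ih, sub_zero]
    congr 1
    cases b with
    | zero => simp [doubleElem_zero]
    | succ b => rw [ih, Polynomial.coeff_X_mul]

/-- The variables `x_{j+1}, …, x_{j+m}`. -/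
noncomputable def xList (j m : ℕ) : List Poly := (List.range' (j + 1) m).map xv

theorem xList_succ (j m : ℕ) : xList j (m + 1) = xv (j + 1) :: xList (j + 1) m := by
  simp [xList, List.range'_succ]

theorem length_xList (j m : ℕ) : (xList j m).length = m := by simp [xList]

theorem exchange_doubleElem (i : ℕ) (xs : List Poly) (b : ℕ) :
    exchange i (doubleElem yv xs b) = doubleElem yv (xs.map (exchange i)) b := by
  have := map_doubleElem
    (MvPolynomial.rename (R := ℤ) (Equiv.swap (Sum.inl i : ℕ ⊕ ℕ) (Sum.inl (i + 1)))).toRingHom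
    yv xs b
  refine this.trans ?_
  congr 1
  funext j
  exact exchange_yv i j

theorem exchange_xList_perm {i j m : ℕ} (h1 : j < i) (h2 : i < j + m) :
    ((xList j m).map (exchange i)).Perm (xList j m) := by
  have e : exchange i ∘ xv = xv ∘ Equiv.swap i (i + 1) := by
    funext k
    simp only [Function.comp, Equiv.swap_apply_def]
    split_ifs with h h'
    · rw [h, exchange_xv_left]
    · rw [h', exchange_xv_right]
    · exact exchange_xv_of_ne h h'
  rw [xList, List.map_map, e, ← List.map_map]
  refine List.Perm.map _ ?_
  rw [List.perm_ext_iff_of_nodup (List.Nodup.map (Equiv.injective _) List.nodup_range') List.nodup_range']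
  intro a
  simp only [List.mem_map, List.mem_range'_1]
  constructor
  · rintro ⟨k, hk, rfl⟩
    simp only [Equiv.swap_apply_def]
    split_ifs <;> omega
  · intro ha
    refine ⟨Equiv.swap i (i + 1) a, ?_, Equiv.swap_apply_self _ _ _⟩
    simp only [Equiv.swap_apply_def]
    split_ifs <;> omega

theorem exchange_doubleElem_xList {i j m : ℕ} (h1 : j < i) (h2 : i < j + m) (b : ℕ) :
    exchange i (doubleElem yv (xList j m) b) = doubleElem yv (xList j m) b := by
  rw [exchange_doubleElem, doubleElem_perm _ (exchange_xList_perm h1 h2)]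

/-! Divided differences of `(x - y_1) ⋯ (x - y_d)` -/

/-- The result of the application of `i` successive divided differences to
`(x_{j+1} - y_1) ⋯ (x_{j+1} - y_d)`. -/
noncomputable def linProdDiff (j : ℕ) : ℕ → ℕ → Poly
  | 0, 0 => 1
  | _ + 1, 0 => 0
  | 0, d + 1 => linProdDiff j 0 d * (xv (j + 1) - yv (d + 1))
  | i + 1, d + 1 => linProdDiff j (i + 1) d * (xv (j + 1 + (i + 1)) - yv (d + 1)) + linProdDiff j i d

theorem linProdDiff_zero_left (j d : ℕ) : linProdDiff j 0 d = linProd (j + 1) d := by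
  induction d with
  | zero => rw [linProdDiff, linProd_zero]
  | succ d ih => rw [linProdDiff, linProd_succ, ih]

theorem linProdDiff_of_lt (j i d : ℕ) (h : d < i) : linProdDiff j i d = 0 := by
  induction d generalizing i with
  | zero =>
    obtain ⟨i, rfl⟩ := Nat.exists_eq_succ_of_ne_zero (show i ≠ 0 by omega)
    rw [linProdDiff]
  | succ d ih =>
    obtain ⟨i, rfl⟩ := Nat.exists_eq_succ_of_ne_zero (show i ≠ 0 by omega)
    rw [linProdDiff, ih _ (by omega), ih _ (by omega)]
    simp

theorem linProdDiff_self (j d : ℕ) : linProdDiff j d d = 1 := by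
  induction d with
  | zero => rw [linProdDiff]
  | succ d ih => rw [linProdDiff, ih, linProdDiff_of_lt _ _ _ (by omega)]; simp

theorem exchange_linProdDiff (j i k d : ℕ) (h : j + 1 + i < k) :
    exchange k (linProdDiff j i d) = linProdDiff j i d := by
  induction d generalizing i with
  | zero => cases i <;> simp [linProdDiff, exchange_one, exchange_zero]
  | succ d ih =>
    cases i <;>
    simp only [linProdDiff, exchange_mul, exchange_add, exchange_sub, exchange_yv, ih _ h]
    · rw [exchange_xv_of_ne (by omega) (by omega)]
    · rw [exchange_xv_of_ne (by omega) (by omega), ih _ (by omega)]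

theorem isDividedDifference_linProdDiff (j i d : ℕ) :
    IsDividedDifference (j + 1 + i) (linProdDiff j i d) (linProdDiff j (i + 1) d) := by
  unfold IsDividedDifference
  induction d with
  | zero => cases i <;> simp [linProdDiff, exchange_one, exchange_zero]
  | succ d ih =>
    rcases i with _ | i
    · simp only [linProdDiff, exchange_mul, exchange_sub, exchange_yv, add_zero, zero_add] at ih ⊢
      rw [exchange_xv_left]
      linear_combination (xv (j + 1 + 1) - yv (d + 1)) * ih
    · have h := exchange_linProdDiff j i (j + 1 + (i + 1)) d (by omega)
      rw [linProdDiff, linProdDiff]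
      simp only [exchange_mul, exchange_add, exchange_sub, exchange_yv, h]
      rw [← add_assoc (j + 1) (i + 1) 1, exchange_xv_left]
      linear_combination (xv (j + 1 + (i + 1) + 1) - yv (d + 1)) * ih

/-! The Schubert polynomials with codes `[0, …, 0, 1, …, 1]` -/

/-- The alternating sum of the products of the double elementary symmetric polynomials in
`x_{j+1}, …, x_{j+m}` with the polynomials `linProdDiff j i c` for `c < d`. -/
noncomputable def elemLinSum (j m i : ℕ) : ℕ → Poly
  | 0 => 0
  | d + 1 => doubleElem yv (xList j m) (d + 1) * linProdDiff j i d - elemLinSum j m i d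

/-- The recursion of `doubleElem` on its first variable makes the alternating sum telescope. -/
theorem elemLinSum_zero_left (j m d : ℕ) :
    elemLinSum j (m + 1) 0 d = linProd (j + 1) d * doubleElem yv (xList (j + 1) m) d := by
  induction d with
  | zero => simp [elemLinSum, doubleElem_zero]
  | succ d ih =>
    rw [elemLinSum, ih, linProdDiff_zero_left, linProd_succ, xList_succ, doubleElem]
    ring

theorem elemLinSum_of_le (j m i d : ℕ) (h : d ≤ i) : elemLinSum j m i d = 0 := by
  induction d with
  | zero => rfl
  | succ d ih => rw [elemLinSum, ih (by omega), linProdDiff_of_lt _ _ _ (by omega)]; simp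

theorem elemLinSum_succ_self (j m d : ℕ) :
    elemLinSum j m d (d + 1) = doubleElem yv (xList j m) (d + 1) := by
  rw [elemLinSum, elemLinSum_of_le _ _ _ _ le_rfl, linProdDiff_self]
  simp

/-- The coefficients are symmetric in x_{j+1}, …, x_{j+m}, so the divided difference acts on the
factors `linProdDiff` only. -/
theorem isDividedDifference_elemLinSum (j m i d : ℕ) (h : i + 1 < m) :
    IsDividedDifference (j + 1 + i) (elemLinSum j m i d) (elemLinSum j m (i + 1) d) := by
  unfold IsDividedDifference
  induction d with
  | zero => simp [elemLinSum, exchange_zero]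
  | succ d ih =>
    have h' : (_ : Poly) = _ := isDividedDifference_linProdDiff j i d
    rw [elemLinSum, elemLinSum, exchange_sub, exchange_mul,
      exchange_doubleElem_xList (by omega) (by omega)]
    linear_combination doubleElem yv (xList j m) (d + 1) * h' - ih

theorem IsDividedDifference.mul_left {i : ℕ} {P Q D : Poly} (h : IsDividedDifference i P Q)
    (hD : exchange i D = D) : IsDividedDifference i (D * P) (D * Q) := by
  unfold IsDividedDifference at *
  rw [exchange_mul, hD]
  linear_combination D * h

/-- Induction on k with j free: one more entry 1 at the end is paid for by one more entry a+1 at the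
front, which travels through the a zeros and loses one unit at each. After a steps only the top term
of `elemLinSum` survives. -/
theorem isSchubert_doubleElem_aux (a k j : ℕ) :
    IsSchubert (List.replicate j (a + 1) ++ (List.replicate a 0 ++ List.replicate k 1))
      (dominantFrom 0 (List.replicate j (a + 1)) * doubleElem yv (xList j (a + k)) (a + 1)) := by
  induction k generalizing j with
  | zero =>
    have h : (List.replicate j (a + 1) ++ (List.replicate a 0 ++ List.replicate 0 1)).SortedGE := by
      rw [List.sortedGE_iff_pairwise]
      simp only [List.replicate_zero, List.append_nil, List.pairwise_append,
        List.pairwise_replicate, List.mem_replicate]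
      refine ⟨by simp, by simp, ?_⟩
      rintro x ⟨-, rfl⟩ y ⟨-, rfl⟩
      omega
    have h1 := doubleElem_length_succ yv (xList j a)
    rw [length_xList] at h1
    have h2 : ∀ c k, dominantFrom k (List.replicate c 0) = 1 := by
      intro c
      induction c with
      | zero => intro k; rfl
      | succ c ih => intro k; rw [List.replicate_succ, dominantFrom, ih, linProd_zero, one_mul]
    have := IsSchubert.dominant _ h
    rw [dominantPoly_eq, dominantFrom_append] at this
    simpa [h1, h2] using this
  | succ k ih =>
    -- State after the travelling entry has passed i zeros.
    have key : ∀ i ≤ a, IsSchubert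
        ((List.replicate j (a + 1) ++ List.replicate i 0) ++
          (a + 1 - i) :: (List.replicate (a - i) 0 ++ List.replicate k 1))
        (dominantFrom 0 (List.replicate j (a + 1)) * elemLinSum j (a + (k + 1)) i (a + 1)) := by
      intro i
      induction i with
      | zero =>
        intro _
        have := ih (j + 1)
        rw [List.replicate_succ', dominantFrom_append] at this
        rw [← add_assoc, elemLinSum_zero_left]
        simpa [dominantFrom, mul_assoc] using this
      | succ i ihi =>
        intro hi
        have h1 := ihi (by omega)
        obtain ⟨c, hc⟩ : ∃ c, a = i + 1 + c := ⟨a - (i + 1), by omega⟩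
        rw [show a - i = c + 1 by omega, List.replicate_succ, List.cons_append] at h1
        have h2 := IsSchubert.divided _ _ _ _ _
          (dominantFrom 0 (List.replicate j (a + 1)) * elemLinSum j (a + (k + 1)) (i + 1) (a + 1))
          (by omega) h1 (by
            refine IsDividedDifference.mul_left ?_ ?_
            · have := isDividedDifference_elemLinSum j (a + (k + 1)) i (a + 1) (by omega)
              simpa [add_assoc, add_comm, add_left_comm] using this
            · exact exchange_dominantFrom_of_lt _ (by simp))
        rw [List.replicate_succ', show a + 1 - (i + 1) = a + 1 - i - 1 by omega,
          show a - (i + 1) = c by omega]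
        simpa using h2
    have h := key a le_rfl
    rw [elemLinSum_succ_self] at h
    simpa [List.replicate_succ] using h

theorem isSchubert_zeroOneCode {n b : ℕ} (hb : 1 ≤ b) (hbn : b ≤ n) :
    IsSchubert (zeroOneCode n b) (doubleElem yv (xList 0 (n - 1)) b) := by
  have := isSchubert_doubleElem_aux (b - 1) (n - b) 0
  rw [show b - 1 + (n - b) = n - 1 by omega, Nat.sub_add_cancel hb] at this
  simpa [zeroOneCode, dominantFrom] using this

theorem aeval_doubleElem_zero {n b : ℕ} (hb : 1 ≤ b) (hbn : b ≤ n) :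
    MvPolynomial.aeval (Sum.elim (fun i => (MvPolynomial.X i : MvPolynomial ℕ ℤ)) fun _ => 0)
        (doubleElem yv (xList 0 (n - 1)) b) =
      MvPolynomial.rename (fun i : Fin (n - 1) => (i : ℕ) + 1)
        (MvPolynomial.esymm (Fin (n - 1)) ℤ (n - b)) := by
  obtain ⟨b, rfl⟩ := Nat.exists_eq_add_of_le' hb
  have h1 := MvPolynomial.prod_X_add_C_coeff ℤ (Fin (n - 1)) b (by simp; omega)
  rw [Fintype.card_fin, show n - 1 - b = n - (b + 1) by omega] at h1
  have h2 := map_doubleElem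
    (MvPolynomial.aeval (Sum.elim (fun i => (MvPolynomial.X i : MvPolynomial ℕ ℤ))
      fun _ => 0)).toRingHom yv (xList 0 (n - 1)) (b + 1)
  refine h2.trans ?_
  have h3 : (fun j => (MvPolynomial.aeval (Sum.elim (fun i => (MvPolynomial.X i : MvPolynomial ℕ ℤ))
      fun _ => 0)).toRingHom (yv j)) = fun _ => 0 := by
    funext j
    simp [yv]
  rw [h3, doubleElem_zero_left, ← h1]
  set f := (MvPolynomial.rename (R := ℤ) (fun i : Fin (n - 1) => (i : ℕ) + 1)).toRingHom
  refine Eq.trans ?_ (Polynomial.coeff_map f b)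
  congr 1
  rw [Polynomial.map_prod, xList, List.map_map, List.map_map, List.range'_eq_map_range,
    List.map_map, ← List.map_coe_finRange_eq_range, List.map_map, ← List.ofFn_eq_map, List.prod_ofFn]
  refine Finset.prod_congr rfl fun i _ => ?_
  simp [f, xv, add_comm]

/-! The partition function as a determinant -/

section Determinant

variable {K : Type*} [Field K]

/-- The operator with `φ u / y u = integ y φ u - integ y φ (u + 1)`. -/
noncomputable def integ (y : ℕ → K) : Module.End K (ℕ → K) where
  toFun φ u := -∑ v ∈ Finset.range u, φ v / y v
  map_add' φ ψ := by
    funext u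
    simp only [Pi.add_apply, add_div, Finset.sum_add_distrib]
    ring
  map_smul' c φ := by
    funext u
    simp only [Pi.smul_apply, smul_eq_mul, RingHom.id_apply, mul_div_assoc, ← Finset.mul_sum]
    ring

theorem integ_sub (y : ℕ → K) (φ : ℕ → K) (u : ℕ) :
    integ y φ u - integ y φ (u + 1) = φ u / y u := by
  simp [integ, Finset.sum_range_succ]

/-- The polynomial `(x_1 X - 1) ⋯ (x_k X - 1)`. -/
noncomputable def stepPoly (x : ℕ → K) (k : ℕ) : Polynomial K :=
  ∏ l ∈ Finset.range k, (Polynomial.C (x (l + 1)) * Polynomial.X - 1)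

theorem stepPoly_succ (x : ℕ → K) (k : ℕ) :
    stepPoly x (k + 1) = (Polynomial.C (x (k + 1)) * Polynomial.X - 1) * stepPoly x k := by
  rw [stepPoly, Finset.prod_range_succ, mul_comm, stepPoly]

theorem stepPoly_succ' (x : ℕ → K) (k : ℕ) :
    stepPoly x (k + 1) =
      (Polynomial.C (x 1) * Polynomial.X - 1) * stepPoly (fun i => x (i + 1)) k := by
  rw [stepPoly, Finset.prod_range_succ', mul_comm, stepPoly]

theorem aeval_step_apply (y : ℕ → K) (c : K) (φ : ℕ → K) (u : ℕ) :
    Polynomial.aeval (integ y) (Polynomial.C c * Polynomial.X - 1) φ u =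
      c * integ y φ u - φ u := by
  simp [Polynomial.aeval_C, Module.algebraMap_end_apply]

/-- The functions whose values are the columns of the determinant. -/
noncomputable def colFun (x y : ℕ → K) (b k i : ℕ) : ℕ → K :=
  if i < k then Polynomial.aeval (integ y) (stepPoly x i) 1
  else Polynomial.aeval (integ y) (stepPoly x k) (Pi.single b 1)

theorem colFun_zero (x y : ℕ → K) (b k : ℕ) : colFun x y b (k + 1) 0 = 1 := by
  simp [colFun, stepPoly]

/-- The factor of x_1 is taken as the outermost operator, since the first row subtraction must
produce the weights of column 1. -/
theorem colFun_succ (x y : ℕ → K) (b k i : ℕ) :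
    colFun x y b (k + 1) (i + 1) =
      Polynomial.aeval (integ y) (Polynomial.C (x 1) * Polynomial.X - 1)
        (colFun (fun i => x (i + 1)) y b k i) := by
  simp only [colFun, add_lt_add_iff_right]
  split_ifs <;> rw [stepPoly_succ', map_mul, Module.End.mul_apply]

/-- The left side telescopes to c ∑_{α≤v<γ} φ(v)/y_v - φ(α) + φ(γ): the boundary terms account for
the special weights at v = α and v = γ. -/
theorem step_sub_step (y : ℕ → K) (c : K) (φ : ℕ → K) {α γ : ℕ} (h : α < γ) :
    Polynomial.aeval (integ y) (Polynomial.C c * Polynomial.X - 1) φ α -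
        Polynomial.aeval (integ y) (Polynomial.C c * Polynomial.X - 1) φ γ =
      ∑ v ∈ Finset.Icc α γ, entryWeight c y α v γ * φ v := by
  have h1 : ∑ v ∈ Finset.Icc α γ, entryWeight c y α v γ * φ v =
      ∑ v ∈ Finset.Ico α γ, (if α = v then c / y v - 1 else c / y v) * φ v + φ γ := by
    rw [← Finset.sum_Ico_add_eq_sum_Icc h.le]
    congr 1
    · refine Finset.sum_congr rfl fun v hv => ?_
      rw [Finset.mem_Ico] at hv
      simp only [entryWeight]
      split_ifs <;> first | rfl | omega
    · simp [entryWeight, h.ne]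
  rw [h1]
  simp only [aeval_step_apply]
  clear h1
  induction γ, h using Nat.le_induction with
  | base =>
    have := integ_sub y φ α
    simp
    linear_combination c * this
  | succ γ hγ ih =>
    have := integ_sub y φ γ
    rw [Finset.sum_Ico_succ_top (by omega), if_neg (by omega)]
    linear_combination ih + c * this

/-- Subtracting from each row the preceding one turns the first column into (1, 0, …, 0). -/
theorem det_eq_det_sub {R : Type*} [CommRing R] {k : ℕ} (M : Matrix (Fin (k + 1)) (Fin (k + 1)) R)
    (h : ∀ j, M j 0 = 1) :
    M.det = (Matrix.of fun j i : Fin k => M j.succ i.succ - M j.castSucc i.succ).det := by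
  let B : Matrix (Fin (k + 1)) (Fin (k + 1)) R :=
    Matrix.of fun j i => Fin.cases (M 0 i) (fun j => M j.succ i - M j.castSucc i) j
  have h1 : M.det = B.det :=
    Matrix.det_eq_of_forall_row_eq_smul_add_pred (fun _ => 1) (fun i => by simp [B])
      (fun j i => by simp [B])
  rw [h1, Matrix.det_succ_column_zero, Fin.sum_univ_succ]
  simp [B, h]
  rfl

theorem det_sum_row {R : Type*} [CommRing R] {k : ℕ} (A : Fin k → Finset ℕ) (w : Fin k → ℕ → R)
    (ψ : Fin k → ℕ → R) :
    (Matrix.of fun j i : Fin k => ∑ v ∈ A j, w j v * ψ i v).det =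
      ∑ r ∈ Fintype.piFinset A, (∏ j, w j (r j)) * (Matrix.of fun j i : Fin k => ψ i (r j)).det := by
  have h := MultilinearMap.map_sum_finset
    (Matrix.detRowAlternating (R := R) (n := Fin k)).toMultilinearMap
    (fun j v => w j v • fun i => ψ i v) A
  have e : (fun j => ∑ v ∈ A j, w j v • fun i => ψ i v) =
      (Matrix.of fun j i : Fin k => ∑ v ∈ A j, w j v * ψ i v) := by
    funext j i
    simp
  rw [e] at h
  refine Eq.trans h (Finset.sum_congr rfl fun r _ => ?_)
  exact MultilinearMap.map_smul_univ
    (Matrix.detRowAlternating (R := R) (n := Fin k)).toMultilinearMap _ _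

/-! ### Peeling off the first column of a staircase -/

theorem getD_ofFn {m : ℕ} (f : Fin m → ℕ) (j : Fin m) : (List.ofFn f).getD j 0 = f j := by
  simp

theorem adjacent_ofFn {k : ℕ} (u : Fin (k + 1) → ℕ) (r : Fin k → ℕ) :
    Adjacent (List.ofFn u) (List.ofFn r) ↔ ∀ j : Fin k, u j.succ ≤ r j ∧ r j ≤ u j.castSucc := by
  simp only [Adjacent, List.length_ofFn, true_and]
  constructor
  · intro h j
    have := h j j.2
    rwa [getD_ofFn r j, ← Fin.val_succ, getD_ofFn u j.succ, ← Fin.val_castSucc j,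
      getD_ofFn u j.castSucc] at this
  · intro h j hj
    have := h ⟨j, hj⟩
    rwa [← getD_ofFn r, ← getD_ofFn u, ← getD_ofFn u] at this

theorem eq_ofFn_of_length {v : List ℕ} {m : ℕ} (h : v.length = m) :
    ∃ r : Fin m → ℕ, v = List.ofFn r := by
  subst h
  exact ⟨v.get, (List.ofFn_get v).symm⟩

theorem cons_mem_staircases {u w : List ℕ} {t : List (List ℕ)} :
    u :: t ∈ staircases u w ↔
      u.SortedGT ∧ (t = [] ∧ u = w ∨ ∃ v, Adjacent u v ∧ t ∈ staircases v w) := by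
  cases t with
  | nil => simp [staircases, IsStaircase]
  | cons v t =>
    simp only [staircases, IsStaircase, Set.mem_ofPred_eq, List.isChain_cons_cons, List.mem_cons,
      List.head?_cons, Option.some.injEq, List.getLast?_cons_cons, ne_eq, reduceCtorEq,
      not_false_eq_true, true_and, false_and, false_or]
    constructor
    · rintro ⟨⟨h1, h2, h3⟩, h4⟩
      exact ⟨h1 u (Or.inl rfl), v, h2, ⟨fun a ha => h1 a (Or.inr ha), h3⟩, rfl, h4⟩
    · rintro ⟨h1, v', h2, ⟨h3, h4⟩, rfl, h5⟩
      exact ⟨⟨fun a ha => ha.elim (fun e => e ▸ h1) (h3 a), h2, h4⟩, h5⟩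

theorem exists_cons_of_mem_staircases {u w : List ℕ} {t : List (List ℕ)} (h : t ∈ staircases u w) :
    ∃ t', t = u :: t' := by
  obtain ⟨-, h, -⟩ := h
  exact List.head?_eq_some_iff.1 h

theorem staircaseWeight_cons_cons (x y : ℕ → K) (u v : List ℕ) (t : List (List ℕ)) :
    staircaseWeight x y (u :: v :: t) =
      (∏ j ∈ Finset.range v.length,
        entryWeight (x 1) y (u.getD (j + 1) 0) (v.getD j 0) (u.getD j 0)) *
      staircaseWeight (fun i => x (i + 1)) y (v :: t) := by
  simp only [staircaseWeight, List.length_cons, Nat.add_sub_cancel]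
  rw [Finset.prod_range_succ', mul_comm]
  simp

theorem partitionFunction_singleton (x y : ℕ → K) (b c : ℕ) :
    partitionFunction x y [c] [b] = (Pi.single b 1 : ℕ → K) c := by
  have h : ∀ t, t ∈ staircases [c] [b] ↔ t = [[c]] ∧ c = b := by
    intro t
    constructor
    · intro ht
      obtain ⟨t, rfl⟩ := exists_cons_of_mem_staircases ht
      rcases (cons_mem_staircases.1 ht).2 with ⟨rfl, h⟩ | ⟨v, hv, ht⟩
      · exact ⟨rfl, by simpa using h⟩
      · obtain rfl : v = [] := List.length_eq_zero_iff.1 (by simpa using hv.1.symm)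
        obtain ⟨t, rfl⟩ := exists_cons_of_mem_staircases ht
        rcases (cons_mem_staircases.1 ht).2 with ⟨-, h⟩ | ⟨v, hv, -⟩
        · simp at h
        · simpa using hv.1
    · rintro ⟨rfl, rfl⟩
      exact cons_mem_staircases.2 ⟨by simp [List.sortedGT_iff_pairwise], Or.inl ⟨rfl, rfl⟩⟩
  rw [partitionFunction]
  by_cases hcb : c = b
  · have e : (staircases_finite [c] [b]).toFinset = {[[c]]} := by
      ext t
      rw [Set.Finite.mem_toFinset, h, Finset.mem_singleton, and_iff_left hcb]
    rw [e]
    simp [hcb, staircaseWeight]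
  · have e : (staircases_finite [c] [b]).toFinset = ∅ := by
      ext t
      rw [Set.Finite.mem_toFinset, h]
      simp [hcb]
    rw [e]
    simp [hcb]

open Classical in
theorem partitionFunction_ofFn_succ (x y : ℕ → K) (b : ℕ) {k : ℕ} (u : Fin (k + 2) → ℕ)
    (hu : StrictAnti u) :
    partitionFunction x y (List.ofFn u) [b] =
      ∑ r ∈ (Fintype.piFinset fun j : Fin (k + 1) => Finset.Icc (u j.succ) (u j.castSucc)).filter
          (fun r => StrictAnti r),
        (∏ j, entryWeight (x 1) y (u j.succ) (r j) (u j.castSucc)) *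
          partitionFunction (fun i => x (i + 1)) y (List.ofFn r) [b] := by
  simp only [partitionFunction, Finset.mul_sum]
  rw [Finset.sum_sigma']
  symm
  refine Finset.sum_bij (fun p _ => List.ofFn u :: p.2) ?_ ?_ ?_ ?_
  · rintro ⟨r, t⟩ h
    simp only [Finset.mem_sigma, Finset.mem_filter, Fintype.mem_piFinset, Finset.mem_Icc,
      Set.Finite.mem_toFinset] at h ⊢
    exact cons_mem_staircases.2 ⟨hu.sortedGT_ofFn, Or.inr ⟨_, (adjacent_ofFn u r).2 h.1.1, h.2⟩⟩
  · rintro ⟨r, t⟩ h ⟨r', t'⟩ h' e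
    simp only [List.cons.injEq, true_and] at e
    subst e
    simp only [Finset.mem_sigma, Set.Finite.mem_toFinset] at h h'
    have := h.2.2.1.symm.trans h'.2.2.1
    simp only [Option.some.injEq] at this
    rw [List.ofFn_injective this]
  · intro t ht
    rw [Set.Finite.mem_toFinset] at ht
    obtain ⟨t, rfl⟩ := exists_cons_of_mem_staircases ht
    rcases (cons_mem_staircases.1 ht).2 with ⟨-, h⟩ | ⟨v, hv, h⟩
    · have := congrArg List.length h
      simp at this
    · have hl := hv.1
      rw [List.length_ofFn] at hl
      obtain ⟨r, rfl⟩ := eq_ofFn_of_length (show v.length = k + 1 by omega)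
      refine ⟨⟨r, t⟩, ?_, rfl⟩
      simp only [Finset.mem_sigma, Finset.mem_filter, Fintype.mem_piFinset, Finset.mem_Icc,
        Set.Finite.mem_toFinset]
      refine ⟨⟨(adjacent_ofFn u r).1 hv, ?_⟩, h⟩
      obtain ⟨t', rfl⟩ := exists_cons_of_mem_staircases h
      exact (cons_mem_staircases.1 h).1.strictAnti
  · rintro ⟨r, t⟩ h
    simp only [Finset.mem_sigma, Set.Finite.mem_toFinset] at h
    obtain ⟨t, rfl⟩ := exists_cons_of_mem_staircases h.2
    dsimp only
    rw [staircaseWeight_cons_cons, List.length_ofFn, Finset.prod_range]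
    congr 1
    refine Finset.prod_congr rfl fun j _ => ?_
    rw [getD_ofFn r j, ← Fin.val_succ, getD_ofFn u j.succ, ← Fin.val_castSucc j,
      getD_ofFn u j.castSucc]

/-- Subtracting rows and expanding by multilinearity gives a sum over all sequences r interlacing u,
with the weights of column 1 and the smaller determinants for r; this is the recursion of the
partition function. -/
theorem partitionFunction_eq_det (x y : ℕ → K) (b : ℕ) {k : ℕ} (u : Fin (k + 1) → ℕ)
    (hu : StrictAnti u) :
    partitionFunction x y (List.ofFn u) [b] =
      (Matrix.of fun j i : Fin (k + 1) => colFun x y b k i (u j)).det := by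
  classical
  induction k generalizing x with
  | zero =>
    simp [partitionFunction_singleton, colFun, stepPoly]
  | succ k ih =>
    rw [det_eq_det_sub _ (fun j => by simp [colFun_zero])]
    have h : (Matrix.of fun j i : Fin (k + 1) =>
        (Matrix.of fun j i : Fin (k + 1 + 1) => colFun x y b (k + 1) i (u j)) j.succ i.succ -
        (Matrix.of fun j i : Fin (k + 1 + 1) => colFun x y b (k + 1) i (u j)) j.castSucc i.succ) =
        Matrix.of fun j i : Fin (k + 1) => ∑ v ∈ Finset.Icc (u j.succ) (u j.castSucc),
          entryWeight (x 1) y (u j.succ) v (u j.castSucc) *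
            colFun (fun i => x (i + 1)) y b k i v := by
      ext j i
      simp only [Matrix.of_apply, Fin.val_succ, colFun_succ]
      exact step_sub_step y _ _ (hu (Fin.castSucc_lt_succ))
    rw [h, det_sum_row _ (fun j v => entryWeight (x 1) y (u j.succ) v (u j.castSucc))
      (fun i v => colFun (fun i => x (i + 1)) y b k i v), partitionFunction_ofFn_succ x y b u hu]
    refine Eq.trans ?_ (Finset.sum_filter_of_ne (p := fun r => StrictAnti r) ?_)
    · refine Finset.sum_congr rfl fun r hr => ?_
      rw [ih _ r (Finset.mem_filter.1 hr).2]
    -- Interlacing forces r_{j+1} ≤ u_{j+1} ≤ r_j, so an r that is not strictly decreasing repeats a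
    -- value and its determinant has two equal rows.
    · intro r hr hne
      rw [Fin.strictAnti_iff_succ_lt]
      intro j
      by_contra hj
      refine hne (mul_eq_zero_of_right _ ?_)
      simp only [Fintype.mem_piFinset, Finset.mem_Icc] at hr
      have h1 := (hr j.succ).2
      have h2 := (hr j.castSucc).1
      rw [← Fin.succ_castSucc] at h1
      refine Matrix.det_zero_of_row_eq (i := j.castSucc) (j := j.succ) (Fin.castSucc_lt_succ).ne ?_
      funext i
      simp only [Matrix.of_apply]
      rw [show r j.castSucc = r j.succ by omega]

end Determinant

/-! Evaluation of the determinant -/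

section Evaluation

variable {K : Type*} [Field K]

/-- The operator `f ↦ (u ↦ y u * (f u - f (u + 1)))`. -/
def diffOp (y : ℕ → K) : Module.End K (ℕ → K) where
  toFun f u := y u * (f u - f (u + 1))
  map_add' f g := by
    funext u
    simp only [Pi.add_apply]
    ring
  map_smul' c f := by
    funext u
    simp only [Pi.smul_apply, smul_eq_mul, RingHom.id_apply]
    ring

theorem diffOp_apply (y f : ℕ → K) (u : ℕ) : diffOp y f u = y u * (f u - f (u + 1)) := rfl

/-- After row subtraction, adding to each column except the last its predecessor leaves x_{i+1} φ_i
/ y_u. Pulling out these factors gives the same determinant one size smaller, with ω replaced by Dω.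
-/
theorem det_columns (x y : ℕ → K) (φ : ℕ → ℕ → K) (h0 : φ 0 = 1)
    (hφ : ∀ i u, φ (i + 1) u - φ (i + 1) (u + 1) =
      x (i + 1) * (φ i u / y u) - (φ i u - φ i (u + 1)))
    (k : ℕ) (hy : ∀ j, 1 ≤ j → j ≤ k → y j ≠ 0) (ω : ℕ → K) :
    (Matrix.of fun j i : Fin (k + 1) => (if (i : ℕ) < k then φ i else ω) (k + 1 - j)).det =
      (∏ m ∈ Finset.range k, ((∏ l ∈ Finset.range m, x (l + 1)) *
        ∏ u ∈ Finset.range (m + 1), (y (u + 1))⁻¹)) * (diffOp y ^ k) ω 1 := by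
  induction k generalizing ω with
  | zero => simp
  | succ k ih =>
    rw [det_eq_det_sub _ (fun j => by simp [h0])]
    let v : Fin (k + 1) → K := fun j => (y (k + 1 - j))⁻¹
    let c : Fin (k + 1) → K := fun i => if (i : ℕ) < k then x (i + 1) else 1
    let M : Matrix (Fin (k + 1)) (Fin (k + 1)) K :=
      Matrix.of fun j i => (if (i : ℕ) < k then φ i else diffOp y ω) (k + 1 - j)
    have hu : ∀ j : Fin (k + 1), k + 1 + 1 - (j : ℕ) = k + 1 - j + 1 := fun j => by omega
    have hk1 : 1 < k + 1 ↔ 0 < k := by omega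
    have hlast : ∀ j : Fin (k + 1), ω (k + 1 - j) - ω (k + 1 - j + 1) =
        (y (k + 1 - j))⁻¹ * diffOp y ω (k + 1 - j) := by
      intro j
      rw [diffOp_apply, inv_mul_cancel_left₀ (hy _ (by omega) (by omega))]
    have h1 := Matrix.det_eq_of_forall_col_eq_smul_add_pred
      (A := Matrix.of fun j i : Fin (k + 1) =>
        (Matrix.of fun j i : Fin (k + 1 + 1) =>
          (if (i : ℕ) < k + 1 then φ i else ω) (k + 1 + 1 - j)) j.succ i.succ -
        (Matrix.of fun j i : Fin (k + 1 + 1) =>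
          (if (i : ℕ) < k + 1 then φ i else ω) (k + 1 + 1 - j)) j.castSucc i.succ)
      (B := Matrix.of fun j i => v j * (Matrix.of fun j i => c i * M j i) j i)
      -- The last column comes from ω and obeys no relation with its predecessor, hence the 0.
      (fun i => if (i : ℕ) + 1 < k then -1 else 0)
      (by
        intro j
        by_cases hk : 0 < k
        · have hM : M j 0 = 1 := congrFun ((if_pos hk).trans h0) _
          simp only [Matrix.of_apply, Fin.val_succ, Fin.val_zero, Fin.val_castSucc, v, c, hM, hu,
            Nat.add_sub_add_right, zero_add, hk1, hk, if_true, hφ, h0, Pi.one_apply]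
          ring
        · have hM : M j 0 = diffOp y ω (k + 1 - j) := congrFun (if_neg hk) _
          simp only [Matrix.of_apply, Fin.val_succ, Fin.val_zero, Fin.val_castSucc, v, c, hM, hu,
            Nat.add_sub_add_right, zero_add, hk1, hk, if_false, hlast, one_mul])
      (by
        intro j i
        simp only [Matrix.of_apply, Fin.val_succ, Fin.val_castSucc, v, c, M, hu,
          Nat.add_sub_add_right, add_lt_add_iff_right]
        rw [if_pos i.2]
        by_cases hk : (i : ℕ) + 1 < k
        · simp only [hk, if_true, hφ _ (k + 1 - (j : ℕ))]
          ring
        · simp only [hk, if_false, hlast]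
          ring)
    rw [h1, Matrix.det_mul_column, Matrix.det_mul_row, ih (fun j h h' => hy j h (by omega)),
      Finset.prod_range_succ, pow_succ, Module.End.mul_apply]
    have e1 : ∏ i, c i = ∏ l ∈ Finset.range k, x (l + 1) := by
      rw [Fin.prod_univ_castSucc, Finset.prod_range]
      simp [c]
    have e2 : ∏ j, v j = ∏ u ∈ Finset.range (k + 1), (y (u + 1))⁻¹ := by
      rw [← Finset.prod_range_reflect, Finset.prod_range]
      refine Finset.prod_congr rfl fun j _ => ?_
      simp only [v]
      congr 2
      omega
    rw [e1, e2]
    ring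

/-! ### Exchanging `integ` for `diffOp` -/

theorem diffOp_pow_congr (y : ℕ → K) {f g : ℕ → K} (m u : ℕ)
    (h : ∀ v, u ≤ v → v ≤ u + m → f v = g v) : (diffOp y ^ m) f u = (diffOp y ^ m) g u := by
  induction m generalizing u with
  | zero => exact h u le_rfl le_rfl
  | succ m ih =>
    rw [pow_succ', Module.End.mul_apply, Module.End.mul_apply, diffOp_apply, diffOp_apply,
      ih u fun v h1 h2 => h v h1 (by omega), ih (u + 1) fun v h1 h2 => h v (by omega) (by omega)]

/-- The polynomial `(x_1 - X) ⋯ (x_k - X)`. -/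
noncomputable def rootPoly (x : ℕ → K) (k : ℕ) : Polynomial K :=
  ∏ l ∈ Finset.range k, (Polynomial.C (x (l + 1)) - Polynomial.X)

theorem aeval_sub_apply (y : ℕ → K) (c : K) (f : ℕ → K) :
    Polynomial.aeval (diffOp y) (Polynomial.C c - Polynomial.X) f = c • f - diffOp y f := by
  simp [Polynomial.aeval_C, Module.algebraMap_end_apply]

theorem diffOp_step (y : ℕ → K) (c : K) (f : ℕ → K) {v : ℕ} (hv : y v ≠ 0) :
    diffOp y (Polynomial.aeval (integ y) (Polynomial.C c * Polynomial.X - 1) f) v =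
      (c • f - diffOp y f) v := by
  have h := integ_sub y f v
  rw [eq_div_iff hv] at h
  simp only [diffOp_apply, aeval_step_apply, Pi.sub_apply, Pi.smul_apply, smul_eq_mul]
  linear_combination c * h

/-- D(xT - 1) = x - D wherever y does not vanish. The m-th power of D at u only sees arguments from
u to u + m, so the nonzero values y_1, …, y_{n-1} suffice. -/
theorem diffOp_pow_stepPoly (x y : ℕ → K) (n : ℕ) (hy : ∀ j, 1 ≤ j → j < n → y j ≠ 0)
    (f : ℕ → K) (m u : ℕ) (hu : 1 ≤ u) (hum : u + m ≤ n) :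
    (diffOp y ^ m) (Polynomial.aeval (integ y) (stepPoly x m) f) u =
      Polynomial.aeval (diffOp y) (rootPoly x m) f u := by
  induction m generalizing u with
  | zero => simp [stepPoly, rootPoly]
  | succ m ih =>
    set g := Polynomial.aeval (integ y) (stepPoly x m) f with hg
    have e1 : (diffOp y ^ m) (diffOp y g) = diffOp y ((diffOp y ^ m) g) := by
      change (diffOp y ^ m * diffOp y) g = (diffOp y * diffOp y ^ m) g
      rw [← pow_succ, ← pow_succ']
    rw [stepPoly_succ, map_mul, Module.End.mul_apply, ← hg, pow_succ, Module.End.mul_apply,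
      diffOp_pow_congr y m u (fun v h1 h2 => diffOp_step y (x (m + 1)) g (hy v (by omega) (by omega))),
      map_sub, map_smul, e1, rootPoly, Finset.prod_range_succ, mul_comm, map_mul,
      Module.End.mul_apply, aeval_sub_apply, ← rootPoly]
    simp only [Pi.sub_apply, Pi.smul_apply, diffOp_apply, ih u hu (by omega),
      ih (u + 1) (by omega) (by omega)]

theorem diffOp_single_zero (y : ℕ → K) :
    diffOp y (Pi.single 0 1) = y 0 • (Pi.single 0 1 : ℕ → K) := by
  funext u
  cases u <;> simp [diffOp_apply]

theorem diffOp_single_succ (y : ℕ → K) (b : ℕ) :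
    diffOp y (Pi.single (b + 1) 1) =
      y (b + 1) • (Pi.single (b + 1) 1 : ℕ → K) - y b • (Pi.single b 1 : ℕ → K) := by
  funext u
  simp only [diffOp_apply, Pi.single_apply, Pi.sub_apply, Pi.smul_apply, smul_eq_mul,
    add_left_inj]
  split_ifs <;> simp_all

/-- δ_0 is an eigenvector of D and vanishes at 1; this matches the value 0 of `doubleElem` at index
0, whatever y_0 is. -/
theorem rootPoly_single_zero (x y : ℕ → K) (m : ℕ) :
    Polynomial.aeval (diffOp y) (rootPoly x m) (Pi.single 0 1) 1 = 0 := by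
  induction m with
  | zero => simp [rootPoly]
  | succ m ih =>
    rw [rootPoly, Finset.prod_range_succ, map_mul, Module.End.mul_apply, aeval_sub_apply,
      ← rootPoly, diffOp_single_zero, ← sub_smul, map_smul, Pi.smul_apply, ih, smul_zero]

/-- (x - D)δ_{b+1} = (x - y_{b+1})δ_{b+1} + y_b δ_b is the recursion of `doubleElem` once δ_{b+1} is
rescaled by y_1⋯y_b. The last factor of the polynomial acts first, hence the reversed list. -/
theorem rootPoly_single_succ (x y : ℕ → K) (m b : ℕ) :
    Polynomial.aeval (diffOp y) (rootPoly x m) (Pi.single (b + 1) 1) 1 =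
      (∏ i ∈ Finset.range b, y (i + 1)) *
        doubleElem y ((List.range m).map fun l => x (l + 1)).reverse (b + 1) := by
  induction m generalizing b with
  | zero => cases b <;> simp [rootPoly, doubleElem]
  | succ m ih =>
    rw [rootPoly, Finset.prod_range_succ, map_mul, Module.End.mul_apply, aeval_sub_apply,
      ← rootPoly, diffOp_single_succ, List.range_succ, List.map_append, List.reverse_append,
      List.map_singleton, List.reverse_singleton, List.singleton_append, doubleElem]
    simp only [map_sub, map_smul, Pi.sub_apply, Pi.smul_apply, smul_eq_mul, ih]
    cases b with
    | zero => rw [rootPoly_single_zero, doubleElem_zero]; ring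
    | succ b => rw [ih, Finset.prod_range_succ]; ring

/-! ### Monomial prefactors and the final formula -/

theorem prod_prod_eq_monom_rho (z : ℕ → K) (k : ℕ) :
    ∏ m ∈ Finset.range k, ∏ l ∈ Finset.range m, z (l + 1) = monom z (rho (k + 1)) := by
  have h : ∀ k, monom z (rho (k + 1)) = ∏ i ∈ Finset.range k, z (i + 1) ^ (k - 1 - i) := by
    intro k
    rw [monom, rho]
    simp only [Nat.add_sub_cancel, List.length_reverse, List.length_range]
    refine Finset.prod_congr rfl fun i hi => ?_
    have hi' : i < ((List.range k).reverse).length := by simpa using hi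
    rw [List.getD_eq_getElem _ _ hi']
    simp
  rw [h]
  induction k with
  | zero => simp
  | succ k ih =>
    rw [Finset.prod_range_succ, ih, Finset.prod_range_succ _ k, ← Finset.prod_mul_distrib]
    simp only [Nat.add_sub_cancel, Nat.sub_self, pow_zero, mul_one]
    refine Finset.prod_congr rfl fun i hi => ?_
    rw [← pow_succ, Finset.mem_range.1 hi |> fun h => show k - 1 - i + 1 = k - i by omega]

theorem prod_eq_mul_monom_zeroOneCode (z : ℕ → K) {n b : ℕ} (hb : 1 ≤ b) (hbn : b ≤ n) :
    ∏ i ∈ Finset.range (n - 1), z (i + 1) =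
      (∏ i ∈ Finset.range (b - 1), z (i + 1)) * monom z (zeroOneCode n b) := by
  rw [monom, zeroOneCode, List.length_append, List.length_replicate, List.length_replicate,
    Finset.prod_range_add, show n - 1 = b - 1 + (n - b) by omega, Finset.prod_range_add]
  congr 1
  have h : ∏ i ∈ Finset.range (b - 1),
      z (i + 1) ^ (List.replicate (b - 1) 0 ++ List.replicate (n - b) 1).getD i 0 = 1 := by
    refine Finset.prod_eq_one fun i hi => ?_
    have hi' := Finset.mem_range.1 hi
    simp [List.getD_eq_getElem?_getD, List.getElem?_append_left, hi']
  rw [h, one_mul]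
  refine Finset.prod_congr rfl fun i hi => ?_
  have hi' := Finset.mem_range.1 hi
  simp [List.getD_eq_getElem?_getD, hi']

theorem fullColumn_eq_ofFn (k : ℕ) :
    fullColumn (k + 1) = List.ofFn fun j : Fin (k + 1) => k + 1 - (j : ℕ) := by
  refine List.ext_getElem (by simp [fullColumn]) fun i h1 h2 => ?_
  have hi : i < k + 1 := by simpa [fullColumn] using h1
  rw [List.getElem_ofFn]
  simp only [fullColumn, List.getElem_reverse, List.length_range', List.getElem_range']
  omega

theorem partitionFunction_fullColumn (x y : ℕ → K) {n b : ℕ} (hb : 1 ≤ b) (hbn : b ≤ n)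
    (hy : ∀ j, 1 ≤ j → j < n → y j ≠ 0) :
    partitionFunction x y (fullColumn n) [b] =
      monom x (rho n) * (monom y (rho n))⁻¹ * (monom y (zeroOneCode n b))⁻¹ *
        doubleElem y ((List.range (n - 1)).map fun l => x (l + 1)) b := by
  obtain ⟨k, rfl⟩ := Nat.exists_eq_add_of_le' (hb.trans hbn)
  have hanti : StrictAnti fun j : Fin (k + 1) => k + 1 - (j : ℕ) := by
    intro i j hij
    have : (i : ℕ) < j := hij
    have := j.2
    simp only
    omega
  have hφ : ∀ i u, Polynomial.aeval (integ y) (stepPoly x (i + 1)) 1 u -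
      Polynomial.aeval (integ y) (stepPoly x (i + 1)) 1 (u + 1) =
        x (i + 1) * (Polynomial.aeval (integ y) (stepPoly x i) 1 u / y u) -
          (Polynomial.aeval (integ y) (stepPoly x i) 1 u -
            Polynomial.aeval (integ y) (stepPoly x i) 1 (u + 1)) := by
    intro i u
    rw [stepPoly_succ, map_mul, Module.End.mul_apply, aeval_step_apply, aeval_step_apply,
      ← integ_sub]
    ring
  have hdet := det_columns x y (fun i => Polynomial.aeval (integ y) (stepPoly x i) 1)
    (by simp [stepPoly]) hφ k (fun j h h' => hy j h (by omega))
    (Polynomial.aeval (integ y) (stepPoly x k) (Pi.single b 1))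
  rw [diffOp_pow_stepPoly x y (k + 1) hy _ k 1 le_rfl (by omega)] at hdet
  rw [fullColumn_eq_ofFn, partitionFunction_eq_det x y b _ hanti]
  refine Eq.trans hdet ?_
  rw [Finset.prod_mul_distrib, prod_prod_eq_monom_rho, Nat.add_sub_cancel]
  -- The inner products are one factor longer than for y^ρ, which leaves 1/(y_1⋯y_k). The factor
  -- y_1⋯y_{b-1} from `rootPoly_single_succ` cancels part of it, and the monomial of the code
  -- remains.
  have e1 : ∏ m ∈ Finset.range k, ∏ u ∈ Finset.range (m + 1), (y (u + 1))⁻¹ =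
      (monom y (rho (k + 1)))⁻¹ * (∏ i ∈ Finset.range k, y (i + 1))⁻¹ := by
    simp only [Finset.prod_range_succ _ (_ : ℕ), Finset.prod_mul_distrib, Finset.prod_inv_distrib]
    rw [← prod_prod_eq_monom_rho]
  have e2 := prod_eq_mul_monom_zeroOneCode y hb hbn
  rw [Nat.add_sub_cancel] at e2
  obtain ⟨b, rfl⟩ := Nat.exists_eq_add_of_le' hb
  have hprod : ∏ i ∈ Finset.range b, y (i + 1) ≠ 0 :=
    Finset.prod_ne_zero_iff.2 fun i hi => hy _ (by omega) (by
      have := Finset.mem_range.1 hi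
      omega)
  rw [e1, e2, rootPoly_single_succ, Nat.add_sub_cancel, mul_inv,
    doubleElem_perm y (List.reverse_perm _)]
  field_simp

end Evaluation

end Staircases

theorem mainTheorem6 (n b : ℕ) (hb : 1 ≤ b) (hbn : b ≤ n) :
    ∃ Y : Staircases.Poly,
      -- `Y` is the Schubert polynomial with code `[0^{b-1}, 1^{n-b}]`, which is well defined
      (∀ P : Staircases.Poly,
        Staircases.IsSchubert (Staircases.zeroOneCode n b) P ↔ P = Y) ∧
      -- the partition function
      (∀ (K : Type*) [Field K] (x y : ℕ → K) (_ : ∀ j, 1 ≤ j → j < n → y j ≠ 0),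
        Staircases.partitionFunction x y (Staircases.fullColumn n) [b] =
          Staircases.monom x (Staircases.rho n) * (Staircases.monom y (Staircases.rho n))⁻¹ *
            (Staircases.monom y (Staircases.zeroOneCode n b))⁻¹ *
            MvPolynomial.aeval (Sum.elim x y) Y) ∧
      -- the specialization `y = 0`: the elementary symmetric function of degree `n - b`
      -- in `x 1, …, x (n-1)`
      MvPolynomial.aeval (Sum.elim (fun i => (MvPolynomial.X i : MvPolynomial ℕ ℤ)) fun _ => 0) Y =
        MvPolynomial.rename (fun i : Fin (n - 1) => (i : ℕ) + 1)
          (MvPolynomial.esymm (Fin (n - 1)) ℤ (n - b)) := by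
  have hY := Staircases.isSchubert_zeroOneCode hb hbn
  refine ⟨_, fun P => ⟨fun hP => (Staircases.existsUnique_isSchubert _).unique hP hY,
    fun h => h ▸ hY⟩, ?_, Staircases.aeval_doubleElem_zero hb hbn⟩
  intro K _ x y hy
  rw [Staircases.partitionFunction_fullColumn x y hb hbn hy]
  congr 1
  have h := Staircases.map_doubleElem (MvPolynomial.aeval (Sum.elim x y)).toRingHom
    Staircases.yv (Staircases.xList 0 (n - 1)) b
  refine Eq.trans ?_ h.symm
  have e1 : (fun j => (MvPolynomial.aeval (R := ℤ) (Sum.elim x y)).toRingHom (Staircases.yv j)) =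
      y := by
    funext j
    simp [Staircases.yv]
  rw [e1, Staircases.xList, List.map_map, List.range'_eq_map_range, List.map_map]
  congr 1
  refine List.map_congr_left fun l _ => ?_
  simp [Staircases.xv, add_comm]
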